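/- A Wang tile is a quadruple $t=(t_e,t_w,t_n,t_s)$ of colors (on its east, west, north and south edges), and a tileset is a finite set $\tau$ of Wang tiles. A tiling of the plane by $\tau$ is a map $f:\mathbb{Z}^2\to\tau$ with $f(i,j)_e=f(i+1,j)_w$ and $f(i,j)_n=f(i,j+1)_s$ for all $i,j\in\mathbb{Z}$; it is periodic if there is an integer $p>0$ with $f(i+p,j)=f(i,j+p)=f(i,j)$ for all $i,j$. Let $n(\tau)$ be the number of tiles of $\tau$, and let $c(\tau)$ be the maximum, over the four sides (east, west, north, south), of the number of distinct colors that occur on that side of the tiles of $\tau$; thus $c(\tau)\le n(\tau)$. **Theorem.** (1) The domino problem for tilesets with $n(\tau)-c(\tau)\le 1$ is decidable: the set of finite lists of Wang tiles, with colors coded by natural numbers, whose underlying tileset $\tau$ satisfies $n(\tau)-c(\tau)\le 1$ and admits a tiling of the plane is a computable (recursive) set. (2) A tileset $\tau$ (with colors in an arbitrary set) such that $n(\tau)-c(\tau)\le 1$ admits a tiling of the plane if and only if it admits a periodic tiling of the plane. -/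

import Mathlib

/-- A Wang tile: a unit square whose four edges carry colors (east, west, north, south). -/
@[ext]
structure WangTile (C : Type*) where
  e : C
  w : C
  n : C
  s : C
  deriving DecidableEq

namespace WangTile

/-- A Wang tile is the same thing as a quadruple of colors. -/
def equivProd (C : Type*) : WangTile C ≃ C × C × C × C where
  toFun t := (t.e, t.w, t.n, t.s)
  invFun q := ⟨q.1, q.2.1, q.2.2.1, q.2.2.2⟩
  left_inv _ := rfl
  right_inv _ := rfl

/-- Wang tiles are fed to algorithms as quadruples of colors. -/
instance instPrimcodable {C : Type*} [Primcodable C] : Primcodable (WangTile C) :=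
  Primcodable.ofEquiv (C × C × C × C) (equivProd C)

end WangTile

/-- A tileset is a finite set of Wang tiles. -/
abbrev Tileset (C : Type*) := Finset (WangTile C)

namespace Tileset

/-- `f` is a tiling of the discrete plane by `τ`; `f i j` is the tile at column `i`, row `j`. -/
def IsTiling {C : Type*} (τ : Tileset C) (f : ℤ → ℤ → WangTile C) : Prop :=
  (∀ i j, f i j ∈ τ) ∧
  (∀ i j, (f i j).e = (f (i + 1) j).w) ∧
  (∀ i j, (f i j).n = (f i (j + 1)).s)

/-- A configuration is periodic if some `p > 0` is both a horizontal and a vertical period. -/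
def IsPeriodic {C : Type*} (f : ℤ → ℤ → WangTile C) : Prop :=
  ∃ p : ℤ, 0 < p ∧ ∀ i j, f (i + p) j = f i j ∧ f i (j + p) = f i j

/-- `τ` tiles the plane. -/
def Tiles {C : Type*} (τ : Tileset C) : Prop :=
  ∃ f : ℤ → ℤ → WangTile C, IsTiling τ f

/-- `τ` admits a periodic tiling of the plane. -/
def TilesPeriodically {C : Type*} (τ : Tileset C) : Prop :=
  ∃ f : ℤ → ℤ → WangTile C, IsTiling τ f ∧ IsPeriodic f

/-- The number `n(τ)` of tiles. -/
def numTiles {C : Type*} (τ : Tileset C) : ℕ := Finset.card τ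

/-- The number `c(τ)`: the maximum over the four sides of the number of distinct colors that
occur on that side of the tiles of `τ`. -/
def numColors {C : Type*} [DecidableEq C] (τ : Tileset C) : ℕ :=
  max (max (Finset.image WangTile.e τ).card (Finset.image WangTile.w τ).card)
    (max (Finset.image WangTile.n τ).card (Finset.image WangTile.s τ).card)

/-- In particular the natural subtraction in `parameter` never truncates. -/
theorem numColors_le_numTiles {C : Type*} [DecidableEq C] (τ : Tileset C) :
    numColors τ ≤ numTiles τ :=
  max_le (max_le Finset.card_image_le Finset.card_image_le)
    (max_le Finset.card_image_le Finset.card_image_le)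

/-- The parameter `n(τ) - c(τ)`. -/
def parameter {C : Type*} [DecidableEq C] (τ : Tileset C) : ℕ :=
  numTiles τ - numColors τ

/-- The tileset given as input to an algorithm by a finite list of tiles with colors in `ℕ`
(order and repetitions in the list are irrelevant). -/
def ofList (l : List (WangTile ℕ)) : Tileset ℕ := l.toFinset

end Tileset

/-! ### Sequences over a finite type that are deterministic or periodic in the past -/

/-! Suppose that the labels on one side, `E`, are injective up to one coincidence `E x = E y`. Along
a row, each tile determines the next except at a branching, where both `x` and `y` fit. By
`hasPeriodic_of_frequently` it is enough that infinitely many horizontal boundaries are periodic far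
in the past with a common period: two of them agree there, and the pigeonhole principle on the
columns between them closes up a torus. This covers the case of infinitely many rows that are
deterministic in the past.

Otherwise `x` and `y` recur arbitrarily early in every high enough row. If the south (or north)
labels read after `x` and after `y` always coincide, they are forced to be periodic
(`exists_period_of_sameLabel`). If not, each label, read at the first distance where it can differ,
becomes a function of the current tile that separates `x` from `y` (`exists_shifted_label`), and
after a shear these new labels match between adjacent rows. When two stacked rows repeat a pair of
tiles, the successors now differ in both rows or in neither (`OneCollision.succ_pair`). Hence three
consecutive rows are jointly deterministic in the past, thus periodic there, or they contain either
a block that stacks on itself or two blocks that exchange their labels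
(`exists_row_of_not_pastDet`). Such blocks form a periodic row that stacks on a shift of itself, and
`hasPeriodic_of_row` concludes.

Decidability follows: periodic tilings are found by searching for torus patterns, and by compactness
the absence of a tiling shows up on a finite square. -/

namespace WangDet

/-- Sufficiently far in the past, `σ` has period `p`. -/
def PastPeriodic {X : Type*} (p : ℕ) (σ : ℤ → X) : Prop :=
  ∃ m : ℤ, ∀ i ≤ m, σ (i + p) = σ i

/-- Sufficiently far in the past, each entry of `σ` is determined by the preceding one. -/
def PastDet {X : Type*} (σ : ℤ → X) : Prop :=
  ∃ m : ℤ, ∀ i k, i ≤ m → k ≤ m → σ i = σ k → σ (i + 1) = σ (k + 1)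

theorem PastPeriodic.map {X Y : Type*} {p : ℕ} {σ : ℤ → X} (h : PastPeriodic p σ) (φ : X → Y) :
    PastPeriodic p (fun i => φ (σ i)) := by
  obtain ⟨m, hm⟩ := h
  exact ⟨m, fun i hi => congrArg φ (hm i hi)⟩

/-- Among the entries of a sequence over a finite type, one value recurs at two times `≤ m`. -/
theorem exists_recurrence {X : Type*} [Finite X] (σ : ℤ → X) (m : ℤ) :
    ∃ a b : ℤ, a < b ∧ b ≤ m ∧ b ≤ a + Nat.card X ∧ σ a = σ b := by
  have : Fintype X := Fintype.ofFinite X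
  obtain ⟨u, v, huv, h⟩ := Fintype.exists_ne_map_eq_of_card_lt
    (fun k : Fin (Fintype.card X + 1) => σ (m - (k : ℕ))) (by simp)
  have hu := u.2
  have hv := v.2
  have huv' : (u : ℕ) ≠ v := fun h => huv (Fin.ext h)
  rw [Nat.card_eq_fintype_card]
  rcases lt_or_gt_of_ne huv' with hlt | hlt
  · exact ⟨m - (v : ℕ), m - (u : ℕ), by omega, by omega, by omega, h.symm⟩
  · exact ⟨m - (u : ℕ), m - (v : ℕ), by omega, by omega, by omega, h⟩

/-- A repetition at distance `d ≤ Nat.card X` propagates forward as long as determinism holds. One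
exists before every time, and the factorial is a multiple of each possible `d`. -/
theorem PastDet.pastPeriodic {X : Type*} [Finite X] {σ : ℤ → X} (h : PastDet σ) :
    PastPeriodic (Nat.card X).factorial σ := by
  obtain ⟨m, hm⟩ := h
  refine ⟨m - (Nat.card X).factorial, fun i hi => ?_⟩
  obtain ⟨a, b, hab, hbi, hd, heq⟩ := exists_recurrence σ i
  obtain ⟨d, rfl⟩ : ∃ d : ℕ, b = a + d := ⟨(b - a).toNat, by omega⟩
  have step : ∀ t : ℕ, a + d + t ≤ m → σ (a + d + t) = σ (a + t) := by
    intro t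
    induction t with
    | zero => intro _; simpa using heq.symm
    | succ t ih =>
      intro ht
      push_cast at ht ⊢
      have := hm (a + d + t) (a + t) (by omega) (by omega) (ih (by omega))
      simpa [add_assoc] using this
  have step' : ∀ k : ℕ, i + d * k ≤ m → σ (i + d * k) = σ i := by
    intro k
    induction k with
    | zero => intro _; simp
    | succ k ih =>
      intro hk
      push_cast at hk ⊢
      have h0 : (0 : ℤ) ≤ d * k := by positivity
      have := step (i + d * k - a).toNat (by rw [Int.toNat_of_nonneg (by omega)]; linarith)
      rw [Int.toNat_of_nonneg (by omega)] at this
      rw [← ih (by linarith), ← show a + (i + d * k - a) = i + d * k by ring, ← this]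
      congr 1; ring
  obtain ⟨k, hk⟩ : d ∣ (Nat.card X).factorial := Nat.dvd_factorial (by omega) (by omega)
  have := step' k (by rw [hk] at hi; push_cast at hi; linarith)
  rw [hk]; push_cast; exact this

/-! ### Criteria for the existence of periodic tilings -/

section Core

variable {T C : Type*} (E W N S : T → C)

/-- `f` is a valid tiling when the west label of a tile meets the east label of the next tile
to its right, and the north label meets the south label of the tile above. -/
def Valid (f : ℤ → ℤ → T) : Prop :=
  (∀ i j, W (f i j) = E (f (i + 1) j)) ∧ (∀ i j, N (f i j) = S (f i (j + 1)))

/-- There is a periodic valid tiling. -/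
def HasPeriodic : Prop :=
  ∃ f : ℤ → ℤ → T, Valid E W N S f ∧ ∃ p : ℤ, 0 < p ∧ ∀ i j, f (i + p) j = f i j ∧ f i (j + p) = f i j

theorem add_one_emod_cases (i P : ℤ) (hP : 0 < P) :
    ((i + 1) % P = i % P + 1) ∨ (i % P + 1 = P ∧ (i + 1) % P = 0) := by
  have h0 := Int.emod_nonneg i hP.ne'
  have h1 := Int.emod_lt_of_pos i hP
  have h2 : (i + 1) % P = (i % P + 1) % P := by simp
  rcases lt_or_ge (i % P + 1) P with h | h
  · left; rw [h2, Int.emod_eq_of_lt (by omega) h]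
  · right
    have : i % P + 1 = P := by omega
    exact ⟨this, by rw [h2, this]; simp⟩

variable {E W N S}

/-- Two rows with the same lower boundary in the past give a periodic tiling. -/
theorem hasPeriodic_of_past_eq [Finite T] {f : ℤ → ℤ → T} (hf : Valid E W N S f) {j₁ j₂ m : ℤ}
    (hj : j₁ < j₂) (h : ∀ i ≤ m, S (f i j₁) = S (f i j₂)) : HasPeriodic E W N S := by
  obtain ⟨Q, hQ⟩ : ∃ Q : ℕ, j₂ = j₁ + Q := ⟨(j₂ - j₁).toNat, by omega⟩
  -- The columns of the strip between the two rows form a sequence over a finite type. Two equal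
  -- columns close the strip horizontally; the common boundary closes it vertically, since all
  -- columns used are at most `m`.
  obtain ⟨a, b, hab, hbm, -, heq⟩ :=
    exists_recurrence (fun i => fun k : Fin Q => f i (j₁ + (k : ℕ))) m
  have hcol : ∀ k : ℤ, 0 ≤ k → k < Q → f a (j₁ + k) = f b (j₁ + k) := by
    intro k h0 h1
    have := congrFun heq ⟨k.toNat, by omega⟩
    simpa [Int.toNat_of_nonneg h0] using this
  set P := b - a with hP
  have hPpos : 0 < P := by omega
  have hQpos : (0 : ℤ) < Q := by omega
  refine ⟨fun i j => f (a + i % P) (j₁ + j % Q), ⟨fun i j => ?_, fun i j => ?_⟩, P * Q,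
    by positivity, fun i j => ⟨?_, ?_⟩⟩
  · have hjn := Int.emod_nonneg j hQpos.ne'
    have hjl := Int.emod_lt_of_pos j hQpos
    rcases add_one_emod_cases i P hPpos with h' | ⟨h', h''⟩
    · simp only [h', hf.1, add_assoc]
    · simp only [h'', hf.1, add_assoc, h', add_zero]
      rw [hcol _ hjn hjl, hP]; simp
  · have hin := Int.emod_nonneg i hPpos.ne'
    have hil := Int.emod_lt_of_pos i hPpos
    rcases add_one_emod_cases j Q hQpos with h' | ⟨h', h''⟩
    · simp only [h', hf.2, add_assoc]
    · simp only [h'', hf.2, add_assoc, h', add_zero]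
      rw [h _ (by omega), hQ]
  · simp
  · simp

/-- Infinitely many boundaries that are periodic in the past, with a common period, give a
periodic tiling. -/
theorem hasPeriodic_of_frequently [Finite T] {f : ℤ → ℤ → T} (hf : Valid E W N S f) {p : ℕ}
    (hp : 0 < p) (h : ∃ᶠ j in Filter.atTop, PastPeriodic p (fun i => S (f i j))) :
    HasPeriodic E W N S := by
  have hinf : {j : ℤ | PastPeriodic p (fun i => S (f i j))}.Infinite := by
    intro hfin
    obtain ⟨b, hb⟩ := hfin.bddAbove
    obtain ⟨j, hj, hj'⟩ := (Filter.frequently_atTop.1 h) (b + 1)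
    have := hb hj'
    omega
  -- The past of a periodic boundary is recorded by one label per residue mod `p`. Taking values in
  -- `Set.range S`, which is finite even if `C` is not, leaves finitely many records.
  have key : ∀ j, ∃ e : Fin p → Set.range S, PastPeriodic p (fun i => S (f i j)) →
      ∃ m : ℤ, ∀ i ≤ m, ∀ r : Fin p, i % p = (r : ℕ) → S (f i j) = e r := by
    intro j
    by_cases hj : PastPeriodic p (fun i => S (f i j))
    · obtain ⟨m, hm⟩ := hj
      obtain ⟨K, hK⟩ : ∃ K : ℤ, K * p + p ≤ m := by
        refine ⟨-(|m| + 1), ?_⟩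
        have : (1 : ℤ) ≤ p := by exact_mod_cast hp
        nlinarith [neg_abs_le m, abs_nonneg m]
      refine ⟨fun r => ⟨S (f (K * p + (r : ℕ)) j), Set.mem_range_self _⟩, fun _ => ⟨K * p, ?_⟩⟩
      intro i hi r hr
      have hi' : i = i / p * p + (r : ℕ) := by rw [← hr, mul_comm]; exact (Int.mul_ediv_add_emod i p).symm
      have hp' : (0 : ℤ) < p := by exact_mod_cast hp
      have hle : i / p ≤ K := by
        have := Int.ediv_le_ediv hp' hi
        rwa [Int.mul_ediv_cancel _ hp'.ne'] at this
      have hper : ∀ n : ℕ, S (f ((K - n) * p + (r : ℕ)) j) = S (f (K * p + (r : ℕ)) j) := by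
        intro n
        induction n with
        | zero => simp
        | succ n ih =>
          rw [← ih]
          have := hm ((K - (n + 1 : ℕ)) * p + (r : ℕ)) (by
            have := r.2
            push_cast
            nlinarith)
          simp only at this
          rw [← this]
          congr 2
          push_cast; ring
      have := hper (K - i / p).toNat
      rw [Int.toNat_of_nonneg (by omega)] at this
      simp only
      rw [← this]
      congr 2
      rw [sub_sub_cancel]; exact hi'
    · exact ⟨fun _ => ⟨S (f 0 0), Set.mem_range_self _⟩, fun h => absurd h hj⟩
  choose e he using key
  obtain ⟨j, hj, j', hj', hne, heq⟩ :=
    hinf.exists_ne_map_eq_of_mapsTo (f := e) (Set.mapsTo_univ _ _) Set.finite_univ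
  wlog hlt : j < j' generalizing j j'
  · exact this j' hj' j hj hne.symm heq.symm (by omega)
  obtain ⟨m, hm⟩ := he j hj
  obtain ⟨m', hm'⟩ := he j' hj'
  refine hasPeriodic_of_past_eq hf (m := min m m') hlt fun i hi => ?_
  have hp' : (0 : ℤ) < p := by exact_mod_cast hp
  have h0 := Int.emod_nonneg i hp'.ne'
  have h1 := Int.emod_lt_of_pos i hp'
  let r : Fin p := ⟨(i % p).toNat, by omega⟩
  have hr : i % p = (r : ℕ) := by simp [r, Int.toNat_of_nonneg h0]
  rw [hm i (by omega) r hr, hm' i (by omega) r hr, heq]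

/-- A periodic row that can be stacked on a shift of itself gives a periodic tiling. -/
theorem hasPeriodic_of_row {ρ : ℤ → T} {P d : ℤ} (hP : 0 < P) (hper : ∀ i, ρ (i + P) = ρ i)
    (hstep : ∀ i, W (ρ i) = E (ρ (i + 1))) (hstack : ∀ i, N (ρ i) = S (ρ (i + d))) :
    HasPeriodic E W N S := by
  have hmul : ∀ (k : ℕ) i, ρ (i + k * P) = ρ i := by
    intro k
    induction k with
    | zero => simp
    | succ k ih => intro i; rw [← ih i, ← hper (i + k * P)]; congr 1; push_cast; ring
  have hmul' : ∀ (k : ℤ) i, ρ (i + k * P) = ρ i := by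
    intro k i
    obtain ⟨n, rfl | rfl⟩ := k.eq_nat_or_neg
    · exact hmul n i
    · rw [← hmul n (i + -n * P)]; congr 1; ring
  refine ⟨fun i j => ρ (i + d * j), ⟨fun i j => ?_, fun i j => ?_⟩, P, hP, fun i j => ⟨?_, ?_⟩⟩
  · simp only [hstep]; congr 2; ring
  · simp only [hstack]; congr 2; ring
  · simp only
    rw [← hper (i + d * j)]; congr 1; ring
  · simp only
    rw [← hmul' d (i + d * j)]; congr 1; ring

end Core

/-! ### Rows with a single branching colour -/

section Branch

variable {T C : Type*} {E W : T → C} {x y : T}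

/-- Bi-infinite rows. -/
def IsRow (E W : T → C) (q : ℤ → T) : Prop := ∀ i, W (q i) = E (q (i + 1))

/-- One-sided infinite rows. -/
def IsRay (E W : T → C) (q : ℕ → T) : Prop := ∀ i, W (q i) = E (q (i + 1))

/-- The label `E` is injective up to the single coincidence `E x = E y`. -/
def OneCollision (E : T → C) (x y : T) : Prop :=
  E x = E y ∧ ∀ t t', E t = E t' → t = t' ∨ (t = x ∧ t' = y) ∨ (t = y ∧ t' = x)

/-- All rays issued from `x` or from `y` carry the same sequence of labels. -/
def SameLabelAt (E W : T → C) (x y : T) (lab : T → C) (s : ℕ) : Prop :=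
  ∀ q q' : ℕ → T, IsRay E W q → IsRay E W q' → q 0 = x → q' 0 = y → lab (q s) = lab (q' s)

theorem IsRow.shift {q : ℤ → T} (h : IsRow E W q) (d : ℤ) : IsRow E W (fun i => q (i + d)) := by
  intro i
  simp only [h (i + d)]
  congr 2; ring

theorem IsRow.ray {q : ℤ → T} (h : IsRow E W q) (i : ℤ) : IsRay E W (fun k : ℕ => q (i + k)) := by
  intro k
  simp only [h (i + k)]
  congr 2; push_cast; ring

theorem IsRay.tail {q : ℕ → T} (h : IsRay E W q) (d : ℕ) : IsRay E W (fun k => q (d + k)) :=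
  fun k => h (d + k)

theorem OneCollision.succ (hE : OneCollision E x y) {q q' : ℤ → T} (hq : IsRow E W q)
    (hq' : IsRow E W q') {i k : ℤ} (h : q i = q' k) :
    q (i + 1) = q' (k + 1) ∨ (q (i + 1) = x ∧ q' (k + 1) = y) ∨
      (q (i + 1) = y ∧ q' (k + 1) = x) :=
  hE.2 _ _ (by rw [← hq i, ← hq' k, h])

/-- Before the first time at which the labels of rays from `x` and `y` can differ, the label at
that distance is a function of the current tile. -/
theorem SameLabelAt.unique (hE : OneCollision E x y) {lab : T → C} {s : ℕ}
    (h : ∀ s' < s, SameLabelAt E W x y lab s') {q q' : ℕ → T} (hq : IsRay E W q)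
    (hq' : IsRay E W q') (h0 : q 0 = q' 0) : lab (q s) = lab (q' s) := by
  classical
  by_cases hall : ∃ m, m ≤ s ∧ q m ≠ q' m
  · obtain ⟨hms, hne⟩ := Nat.find_spec hall
    have hmin := fun k => Nat.find_min hall (m := k)
    generalize Nat.find hall = m at hms hne hmin
    rcases m with - | m
    · exact absurd h0 hne
    · have hm : q m = q' m := by
        by_contra hc
        exact hmin m (by omega) ⟨by omega, hc⟩
      have hlt : s - (m + 1) < s := by omega
      have hs : m + 1 + (s - (m + 1)) = s := by omega
      rcases hE.2 _ _ (show E (q (m + 1)) = E (q' (m + 1)) by rw [← hq, ← hq', hm]) with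
        h' | ⟨h', h''⟩ | ⟨h', h''⟩
      · exact absurd h' hne
      · simpa [hs] using h _ hlt _ _ (hq.tail (m + 1)) (hq'.tail (m + 1)) h' h''
      · simpa [hs] using (h _ hlt _ _ (hq'.tail (m + 1)) (hq.tail (m + 1)) h'' h').symm
  · push Not at hall
    rw [hall s le_rfl]

/-- The shifted label. -/
theorem exists_shifted_label (hE : OneCollision E x y) {lab : T → C}
    (h : ¬ ∀ s, SameLabelAt E W x y lab s) :
    ∃ (s : ℕ) (lab' : T → C), (∀ q : ℤ → T, IsRow E W q → ∀ i, lab (q (i + s)) = lab' (q i)) ∧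
      lab' x ≠ lab' y := by
  classical
  push Not at h
  have hmin := fun k => Nat.find_min h (m := k)
  have hspec := Nat.find_spec h
  set s := Nat.find h
  have huniq : ∀ q q' : ℕ → T, IsRay E W q → IsRay E W q' → q 0 = q' 0 → lab (q s) = lab (q' s) :=
    fun q q' => SameLabelAt.unique hE (fun s' hs' => not_not.1 (hmin s' hs'))
  -- The value at a tile that starts no ray is arbitrary: such a tile occurs in no row.
  let lab' : T → C := fun t =>
    if ht : ∃ q, IsRay E W q ∧ q 0 = t then lab (ht.choose s) else lab t
  have hlab' : ∀ q, IsRay E W q → lab (q s) = lab' (q 0) := by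
    intro q hq
    have ht : ∃ q', IsRay E W q' ∧ q' 0 = q 0 := ⟨q, hq, rfl⟩
    simp only [lab', dif_pos ht]
    exact huniq _ _ hq ht.choose_spec.1 ht.choose_spec.2.symm
  refine ⟨s, lab', fun q hq i => by simpa using hlab' _ (hq.ray i), fun hxy => hspec ?_⟩
  intro q q' hq hq' h0 h0'
  rw [hlab' q hq, hlab' q' hq', h0, h0', hxy]

/-- If a row is not deterministic in the past, both `x` and `y` occur arbitrarily early. -/
theorem OneCollision.exists_of_not_pastDet (hE : OneCollision E x y) {q : ℤ → T}
    (hq : IsRow E W q) (h : ¬ PastDet q) (m : ℤ) : (∃ i ≤ m, q i = x) ∧ ∃ i ≤ m, q i = y := by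
  simp only [PastDet, not_exists] at h
  have := h (m - 1)
  push Not at this
  obtain ⟨i, k, hi, hk, h1, h2⟩ := this
  rcases hE.succ hq hq h1 with h | ⟨h, h'⟩ | ⟨h, h'⟩
  · exact absurd h h2
  · exact ⟨⟨_, by omega, h⟩, ⟨_, by omega, h'⟩⟩
  · exact ⟨⟨_, by omega, h'⟩, ⟨_, by omega, h⟩⟩

/-- If rays from `x` and `y` all carry the same labels, then there is a common period of the label
sequences of all rows that are not deterministic in the past. -/
theorem exists_period_of_sameLabel (hE : OneCollision E x y) {lab : T → C}
    (h : ∀ s, SameLabelAt E W x y lab s) {q₀ : ℤ → T} (hq₀ : IsRow E W q₀) (h₀ : ¬ PastDet q₀) :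
    ∃ d : ℕ, 0 < d ∧ ∀ q : ℤ → T, IsRow E W q → ¬ PastDet q → PastPeriodic d (fun i => lab (q i)) := by
  -- The ray from `y` at `b` is a common reference for all rays from `x`. Two occurrences `c < a` of
  -- `x` then make the reference label sequence invariant under shift by `a - c`.
  obtain ⟨⟨a, -, ha⟩, ⟨b, -, hb⟩⟩ := hE.exists_of_not_pastDet hq₀ h₀ 0
  obtain ⟨c, hca, hc⟩ := (hE.exists_of_not_pastDet hq₀ h₀ (a - 1)).1
  have hx : ∀ q, IsRay E W q → q 0 = x → ∀ s, lab (q s) = lab (q₀ (b + s)) :=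
    fun q hq hq0 s => h s q _ hq (hq₀.ray b) hq0 (by simpa using hb)
  refine ⟨(a - c).toNat, by omega, fun q hq hnd => ⟨0, fun i _ => ?_⟩⟩
  obtain ⟨r, hri, hr⟩ := (hE.exists_of_not_pastDet hq hnd i).1
  have e1 := hx _ (hq.ray r) (by simpa using hr) (i - r).toNat
  have e2 := hx _ (hq.ray r) (by simpa using hr) (i + (a - c) - r).toNat
  have e3 := hx _ (hq₀.ray c) (by simpa using hc) (i + (a - c) - r).toNat
  have e4 := hx _ (hq₀.ray a) (by simpa using ha) (i - r).toNat
  rw [Int.toNat_of_nonneg (by omega)] at e1 e2 e3 e4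
  rw [Int.toNat_of_nonneg (by omega)]
  simp only
  rw [show i = r + (i - r) by ring, e1, ← e4, show r + (i - r) + (a - c) = r + (i + (a - c) - r) by ring,
    e2, ← e3]
  congr 2; ring

/-! ### Stacks of rows whose labels separate the two branches -/

variable {n s : T → C}

/-- Two blocks that exchange their labels can be concatenated to a periodic row that stacks on a
shift of itself. -/
theorem exists_row_of_blocks (p₀ p₁ : ℕ → T) (L : ℕ) (hL : 0 < L) (a : C)
    (hp₀ : ∀ m, m + 1 < L → W (p₀ m) = E (p₀ (m + 1)))
    (hp₁ : ∀ m, m + 1 < L → W (p₁ m) = E (p₁ (m + 1)))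
    (h₀ : E (p₀ 0) = a) (h₁ : E (p₁ 0) = a) (h₀' : W (p₀ (L - 1)) = a) (h₁' : W (p₁ (L - 1)) = a)
    (hns : ∀ m < L, n (p₀ m) = s (p₁ m)) (hns' : ∀ m < L, n (p₁ m) = s (p₀ m)) :
    ∃ (ρ : ℤ → T) (P d : ℤ), 0 < P ∧ (∀ i, ρ (i + P) = ρ i) ∧ IsRow E W ρ ∧
      ∀ i, n (ρ i) = s (ρ (i + d)) := by
  have hL' : (0 : ℤ) < L := by exact_mod_cast hL
  -- The row alternates `p₀ p₁ p₀ p₁ ...`; it has period `2 * L`, and a shift by `L` swaps the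
  -- blocks.
  refine ⟨fun i => if Even (i / L) then p₀ (i % L).toNat else p₁ (i % L).toNat, 2 * L, L, by omega,
    fun i => ?_, fun i => ?_, fun i => ?_⟩
  · have : (i + 2 * L) / L = i / L + 2 := Int.add_mul_ediv_right _ _ hL'.ne'
    simp [this]
  · have h0 := Int.emod_nonneg i hL'.ne'
    rcases add_one_emod_cases i L hL' with h | ⟨h, h'⟩
    · have hdiv : (i + 1) / L = i / L := by
        have e1 := Int.mul_ediv_add_emod i L
        have e2 := Int.mul_ediv_add_emod (i + 1) L
        have : (L : ℤ) * ((i + 1) / L) = L * (i / L) := by linarith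
        exact mul_left_cancel₀ hL'.ne' this
      have hlt := Int.emod_lt_of_pos (i + 1) hL'
      have : (i % L + 1).toNat = (i % L).toNat + 1 := by omega
      simp only [hdiv, h, this]
      split_ifs
      · exact hp₀ _ (by omega)
      · exact hp₁ _ (by omega)
    · have : (i % L).toNat = L - 1 := by omega
      simp only [h', this, Int.toNat_zero]
      split_ifs <;> simp [*]
  · have hlt := Int.emod_lt_of_pos i hL'
    have h0 := Int.emod_nonneg i hL'.ne'
    have : (i + L) / L = i / L + 1 := by
      simpa using Int.add_mul_ediv_right i 1 hL'.ne'
    simp only [this, Int.even_add_one, Int.add_emod_right]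
    split_ifs
    · exact hns _ (by omega)
    · exact hns' _ (by omega)

end Branch

section Branch

variable {T C : Type*} {E W : T → C} {x y : T} {n s : T → C}

/-- Two stacked rows agreeing with two other stacked rows at some time still agree at the next
time, unless all four branch. -/
theorem OneCollision.succ_pair (hE : OneCollision E x y) (hn : n x ≠ n y) (hs : s x ≠ s y)
    {q₀ q₁ r₀ r₁ : ℤ → T} (h₀ : IsRow E W q₀) (h₁ : IsRow E W q₁) (k₀ : IsRow E W r₀)
    (k₁ : IsRow E W r₁) (hq : ∀ i, n (q₀ i) = s (q₁ i)) (hr : ∀ i, n (r₀ i) = s (r₁ i)) {i k : ℤ}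
    (e₀ : q₀ i = r₀ k) (e₁ : q₁ i = r₁ k) :
    (q₀ (i + 1) = r₀ (k + 1) ∧ q₁ (i + 1) = r₁ (k + 1)) ∨
      (((q₀ (i + 1) = x ∧ r₀ (k + 1) = y) ∨ (q₀ (i + 1) = y ∧ r₀ (k + 1) = x)) ∧
        ((q₁ (i + 1) = x ∧ r₁ (k + 1) = y) ∨ (q₁ (i + 1) = y ∧ r₁ (k + 1) = x))) := by
  have a := hE.succ h₀ k₀ e₀
  have b := hE.succ h₁ k₁ e₁
  have c := hq (i + 1)
  have d := hr (k + 1)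
  rcases a with a | a
  · rcases b with b | b
    · exact Or.inl ⟨a, b⟩
    · rw [a, d] at c
      rcases b with ⟨b, b'⟩ | ⟨b, b'⟩ <;> rw [b, b'] at c
      · exact absurd c.symm hs
      · exact absurd c hs
  · rcases b with b | b
    · rw [b, ← d] at c
      rcases a with ⟨a, a'⟩ | ⟨a, a'⟩ <;> rw [a, a'] at c
      · exact absurd c hn
      · exact absurd c.symm hn
    · exact Or.inr ⟨a, b⟩

/-- Two stacked rows that coincide at a branching, and branch again later, contain a loop that
stacks on itself. -/
theorem exists_row_of_eq (hE : OneCollision E x y) {q₀ q₁ : ℤ → T} (h₀ : IsRow E W q₀)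
    (h₁ : IsRow E W q₁) (hq : ∀ i, n (q₀ i) = s (q₁ i)) {i i' : ℤ} (hlt : i < i')
    (hi : q₀ i = x ∨ q₀ i = y) (hi' : q₀ i' = x ∨ q₀ i' = y) (heq : q₀ i = q₁ i) :
    ∃ (ρ : ℤ → T) (P d : ℤ), 0 < P ∧ (∀ i, ρ (i + P) = ρ i) ∧ IsRow E W ρ ∧
      ∀ i, n (ρ i) = s (ρ (i + d)) := by
  classical
  have hex : ∃ L : ℕ, 0 < L ∧ (q₀ (i + L) = x ∨ q₀ (i + L) = y) := by
    refine ⟨(i' - i).toNat, by omega, ?_⟩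
    rw [Int.toNat_of_nonneg (by omega)]
    simpa using hi'
  obtain ⟨hL, hLb⟩ := Nat.find_spec hex
  have hmin := fun k => Nat.find_min hex (m := k)
  generalize Nat.find hex = L at hL hLb hmin
  have hcol : ∀ t, t = x ∨ t = y → E t = E x := by
    rintro t (rfl | rfl)
    · rfl
    · exact hE.1.symm
  -- Before the first return of `q₀` to `{x, y}` no choice is available, so the two rows keep
  -- agreeing.
  have hag : ∀ m : ℕ, m < L → q₀ (i + m) = q₁ (i + m) := by
    intro m
    induction m with
    | zero => intro _; simpa using heq
    | succ m ih =>
      intro hm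
      have hno := hmin (m + 1) hm
      push_cast at hno ⊢
      rw [← add_assoc] at hno ⊢
      rcases hE.succ h₀ h₁ (ih (by omega)) with h | ⟨h, -⟩ | ⟨h, -⟩
      · exact h
      · exact absurd ⟨by omega, Or.inl h⟩ hno
      · exact absurd ⟨by omega, Or.inr h⟩ hno
  have hstep : ∀ m, m + 1 < L → W (q₀ (i + m)) = E (q₀ (i + (m + 1 : ℕ))) := by
    intro m _
    rw [h₀]; congr 2; push_cast; ring
  have hend : W (q₀ (i + (L - 1 : ℕ))) = E x := by
    rw [h₀, ← hcol _ hLb]; congr 2; push_cast [Nat.cast_sub (show 1 ≤ L from hL)]; ring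
  have hlab : ∀ m < L, n (q₀ (i + m)) = s (q₀ (i + m)) := by
    intro m hm
    rw [hq, hag m hm]
  exact exists_row_of_blocks (fun m : ℕ => q₀ (i + m)) (fun m : ℕ => q₀ (i + m)) L hL (E x)
    hstep hstep (by simpa using hcol _ hi) (by simpa using hcol _ hi) hend hend hlab hlab

/-- Three stacked rows with the branchings `(u, v, u)` and `(v, u, v)`, the first of which is
followed by another branching: up to the next branching of two adjacent rows, the outer rows agree,
and the two blocks exchange their labels. -/
theorem exists_row_of_alternating (hE : OneCollision E x y) (hn : n x ≠ n y) (hs : s x ≠ s y)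
    {q₀ q₁ q₂ : ℤ → T} (h₀ : IsRow E W q₀)
    (h₁ : IsRow E W q₁) (h₂ : IsRow E W q₂) (hq : ∀ i, n (q₀ i) = s (q₁ i))
    (hq' : ∀ i, n (q₁ i) = s (q₂ i)) {i i' k : ℤ} (hlt : i < i')
    (hi₀ : E (q₀ i) = E x) (hi₁ : E (q₁ i) = E x)
    (hi₀' : q₀ i' = x ∨ q₀ i' = y) (hi₁' : q₁ i' = x ∨ q₁ i' = y)
    (e₁ : q₀ i = q₁ k) (e₂ : q₁ i = q₂ k) (e₃ : q₁ i = q₀ k) (e₄ : q₂ i = q₁ k) :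
    ∃ (ρ : ℤ → T) (P d : ℤ), 0 < P ∧ (∀ i, ρ (i + P) = ρ i) ∧ IsRow E W ρ ∧
      ∀ i, n (ρ i) = s (ρ (i + d)) := by
  classical
  let B : T → Prop := fun t => t = x ∨ t = y
  have hex : ∃ L : ℕ, 0 < L ∧ ((B (q₀ (i + L)) ∧ B (q₁ (i + L))) ∨
      (B (q₁ (i + L)) ∧ B (q₂ (i + L)))) := by
    refine ⟨(i' - i).toNat, by omega, ?_⟩
    rw [Int.toNat_of_nonneg (by omega)]
    left
    simpa using ⟨hi₀', hi₁'⟩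
  obtain ⟨hL, hLb⟩ := Nat.find_spec hex
  have hmin := fun k => Nat.find_min hex (m := k)
  generalize Nat.find hex = L at hL hLb hmin
  have hcol : ∀ t, B t → E t = E x := by
    rintro t (rfl | rfl)
    · rfl
    · exact hE.1.symm
  have hB : ∀ {t t'}, ((t = x ∧ t' = y) ∨ (t = y ∧ t' = x)) → B t := by
    rintro t t' (⟨h, -⟩ | ⟨h, -⟩)
    · exact Or.inl h
    · exact Or.inr h
  -- The pairs `(q₀, q₁)` and `(q₁, q₂)` at `i` follow the pairs `(q₁, q₂)` and `(q₀, q₁)` at `k`; a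
  -- disagreement would need an adjacent pair to branch jointly before `L`.
  have hag : ∀ m : ℕ, m < L → (q₀ (i + m) = q₁ (k + m) ∧ q₁ (i + m) = q₂ (k + m)) ∧
      (q₁ (i + m) = q₀ (k + m) ∧ q₂ (i + m) = q₁ (k + m)) := by
    intro m
    induction m with
    | zero => intro _; simpa using ⟨⟨e₁, e₂⟩, e₃, e₄⟩
    | succ m ih =>
      intro hm
      have hno := hmin (m + 1) hm
      push_cast at hno ⊢
      rw [← add_assoc] at hno ⊢
      rw [← add_assoc]
      obtain ⟨⟨a, b⟩, c, d⟩ := ih (by omega)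
      constructor
      · rcases hE.succ_pair hn hs h₀ h₁ h₁ h₂ hq hq' a b with h | ⟨h, h'⟩
        · exact h
        · exact absurd ⟨by omega, Or.inl ⟨hB h, hB h'⟩⟩ hno
      · rcases hE.succ_pair hn hs h₁ h₂ h₀ h₁ hq' hq c d with h | ⟨h, h'⟩
        · exact h
        · exact absurd ⟨by omega, Or.inr ⟨hB h, hB h'⟩⟩ hno
  have houter : ∀ m : ℕ, m < L → q₀ (i + m) = q₂ (i + m) := fun m hm =>
    (hag m hm).1.1.trans (hag m hm).2.2.symm
  have hend : ∀ q, IsRow E W q → W (q (i + (L - 1 : ℕ))) = E (q (i + L)) := by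
    intro q h
    rw [h]; congr 2; push_cast [Nat.cast_sub (show 1 ≤ L from hL)]; ring
  have hstep : ∀ q, IsRow E W q → ∀ m, m + 1 < L → W (q (i + m)) = E (q (i + (m + 1 : ℕ))) := by
    intro q h m _
    rw [h]; congr 2; push_cast; ring
  have hend₁ : W (q₁ (i + (L - 1 : ℕ))) = E x := by
    rw [hend _ h₁]
    rcases hLb with ⟨-, h⟩ | ⟨h, -⟩ <;> exact hcol _ h
  have hend₀ : W (q₀ (i + (L - 1 : ℕ))) = E x := by
    rcases hLb with ⟨h, -⟩ | ⟨-, h⟩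
    · rw [hend _ h₀, hcol _ h]
    · rw [houter _ (by omega), hend _ h₂, hcol _ h]
  refine exists_row_of_blocks (fun m : ℕ => q₀ (i + m)) (fun m : ℕ => q₁ (i + m)) L hL (E x)
    (hstep _ h₀) (hstep _ h₁) (by simpa using hi₀) (by simpa using hi₁) hend₀ hend₁
    (fun m _ => hq _) (fun m hm => ?_)
  rw [hq', houter m hm]

/-- Three stacked rows, with labels separating the two branches, are jointly deterministic in the
past or contain a periodic row that stacks on a shift of itself. -/
theorem exists_row_of_not_pastDet (hE : OneCollision E x y) (hn : n x ≠ n y) (hs : s x ≠ s y)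
    {q₀ q₁ q₂ : ℤ → T} (h₀ : IsRow E W q₀)
    (h₁ : IsRow E W q₁) (h₂ : IsRow E W q₂) (hq : ∀ i, n (q₀ i) = s (q₁ i))
    (hq' : ∀ i, n (q₁ i) = s (q₂ i)) (hnd : ¬ PastDet (fun i => (q₀ i, q₁ i, q₂ i))) :
    ∃ (ρ : ℤ → T) (P d : ℤ), 0 < P ∧ (∀ i, ρ (i + P) = ρ i) ∧ IsRow E W ρ ∧
      ∀ i, n (ρ i) = s (ρ (i + d)) := by
  let Sw : T → T → Prop := fun t t' => (t = x ∧ t' = y) ∨ (t = y ∧ t' = x)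
  -- A failure of joint determinism changes some row, and the middle row transmits the change: all
  -- three rows branch at once.
  have hcut : ∀ m : ℤ, ∃ i k, i ≤ m ∧ k ≤ m ∧ Sw (q₀ i) (q₀ k) ∧ Sw (q₁ i) (q₁ k) ∧
      Sw (q₂ i) (q₂ k) := by
    intro m
    simp only [PastDet, not_exists] at hnd
    have := hnd (m - 1)
    push Not at this
    obtain ⟨i, k, hi, hk, he, hne⟩ := this
    simp only [Prod.mk.injEq] at he
    obtain ⟨a, b, c⟩ := he
    have p := hE.succ_pair hn hs h₀ h₁ h₀ h₁ hq hq a b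
    have p' := hE.succ_pair hn hs h₁ h₂ h₁ h₂ hq' hq' b c
    have hxy : x ≠ y := fun h => hn (h ▸ rfl)
    have hno : ∀ {t t'}, Sw t t' → t ≠ t' := by
      rintro t t' (⟨rfl, rfl⟩ | ⟨rfl, rfl⟩)
      · exact hxy
      · exact hxy.symm
    refine ⟨i + 1, k + 1, by omega, by omega, ?_⟩
    rcases p with ⟨p, r⟩ | ⟨p, r⟩
    · rcases p' with ⟨-, r'⟩ | ⟨p', -⟩
      · exact absurd (by rw [p, r, r']) hne
      · exact absurd r (hno p')
    · rcases p' with ⟨p', -⟩ | ⟨-, r'⟩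
      · exact absurd p' (hno r)
      · exact ⟨p, r, r'⟩
  have hB : ∀ {t t'}, Sw t t' → t = x ∨ t = y := by
    rintro t t' (⟨h, -⟩ | ⟨h, -⟩)
    · exact Or.inl h
    · exact Or.inr h
  have hcol : ∀ t, (t = x ∨ t = y) → E t = E x := by
    rintro t (rfl | rfl)
    · rfl
    · exact hE.1.symm
  obtain ⟨i', _, -, -, b₀, b₁, -⟩ := hcut 0
  obtain ⟨i, k, hi, -, c₀, c₁, c₂⟩ := hcut (i' - 1)
  by_cases e : q₀ i = q₁ i
  · exact exists_row_of_eq hE h₀ h₁ hq (show i < i' by omega) (hB c₀) (hB b₀) e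
  by_cases e' : q₁ i = q₂ i
  · exact exists_row_of_eq hE h₁ h₂ hq' (show i < i' by omega) (hB c₁) (hB b₁) e'
  -- Both adjacent pairs now differ at `i`, so the branchings at `i` and `k` read `(u, v, u)` and
  -- `(v, u, v)` with `{u, v} = {x, y}`.
  have hsw : ∀ {t t' u u'}, Sw t t' → Sw u u' → t ≠ u → t = u' ∧ u = t' := by
    rintro t t' u u' (⟨rfl, rfl⟩ | ⟨rfl, rfl⟩) (⟨rfl, rfl⟩ | ⟨rfl, rfl⟩) hne <;> simp_all
  refine exists_row_of_alternating hE hn hs h₀ h₁ h₂ hq hq' (show i < i' by omega)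
    (k := k) (hcol _ (hB c₀)) (hcol _ (hB c₁)) (hB b₀) (hB b₁) ?_ ?_ ?_ ?_
  · exact (hsw c₀ c₁ e).1
  · exact (hsw c₁ c₂ e').1
  · exact (hsw c₀ c₁ e).2
  · exact (hsw c₁ c₂ e').2

end Branch

/-! ### Periodic tilings -/

section Core

variable {T C : Type*} {E W N S : T → C} {x y : T}

theorem OneCollision.hasPeriodic [Finite T] (hE : OneCollision E x y) {f : ℤ → ℤ → T}
    (hf : Valid E W N S f) : HasPeriodic E W N S := by
  have hrow : ∀ j, IsRow E W (fun i => f i j) := fun j i => hf.1 i j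
  by_cases hdet : ∃ᶠ j in Filter.atTop, PastDet (fun i => f i j)
  · exact hasPeriodic_of_frequently hf (Nat.factorial_pos _)
      (hdet.mono fun j hj => hj.pastPeriodic.map S)
  rw [Filter.not_frequently] at hdet
  obtain ⟨J, hJ⟩ := Filter.eventually_atTop.1 hdet
  by_cases hS : ∀ s, SameLabelAt E W x y S s
  · obtain ⟨d, hd, h⟩ := exists_period_of_sameLabel hE hS (hrow J) (hJ J le_rfl)
    exact hasPeriodic_of_frequently hf hd (hdet.mono fun j hj => h _ (hrow j) hj).frequently
  by_cases hN : ∀ s, SameLabelAt E W x y N s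
  · obtain ⟨d, hd, h⟩ := exists_period_of_sameLabel hE hN (hrow J) (hJ J le_rfl)
    refine hasPeriodic_of_frequently hf hd (Filter.Eventually.frequently ?_)
    refine Filter.eventually_atTop.2 ⟨J + 1, fun j hj => ?_⟩
    have := h _ (hrow (j - 1)) (hJ (j - 1) (by omega))
    simpa [hf.2] using this
  obtain ⟨a, n, hn, hnxy⟩ := exists_shifted_label hE hN
  obtain ⟨b, s, hs, hsxy⟩ := exists_shifted_label hE hS
  set δ : ℤ := a - b with hδ
  have hrow' : ∀ j d, IsRow E W (fun i => f (i + d) j) := fun j d => (hrow j).shift d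
  -- North labels are read `a` steps ahead and south labels `b` steps ahead, so the shear per row is
  -- `a - b`.
  have hlink : ∀ i j, n (f i j) = s (f (i + δ) (j + 1)) := by
    intro i j
    rw [← hn _ (hrow j), ← hs _ (hrow (j + 1)), hf.2]
    congr 2; rw [hδ]; ring
  by_cases htri : ∃ᶠ j in Filter.atTop,
      PastDet (fun i => (f i j, f (i + δ) (j + 1), f (i + δ + δ) (j + 1 + 1)))
  · exact hasPeriodic_of_frequently hf (Nat.factorial_pos _)
      (htri.mono fun j hj => hj.pastPeriodic.map fun t => S t.1)
  rw [Filter.not_frequently] at htri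
  obtain ⟨j, hj⟩ := htri.exists
  obtain ⟨ρ, P, d, hP, hper, hρ, hst⟩ := exists_row_of_not_pastDet hE hnxy hsxy
    (hrow j) (hrow' (j + 1) δ) ((hrow' (j + 1 + 1) δ).shift δ) (fun i => hlink i j)
    (fun i => hlink (i + δ) (j + 1)) hj
  refine hasPeriodic_of_row (d := d + b - a) hP hper hρ fun i => ?_
  have := hst (i - a)
  rw [← hn _ hρ, ← hs _ hρ] at this
  rw [show i = i - a + a by ring, this]
  congr 2; ring

end Core

/-! ### Tilesets whose parameter is at most one -/

/-- `g` is injective on `l` away from the element `t₀`. -/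
def InjOffPoint {T C : Type*} (g : T → C) (l : T → Prop) : Prop :=
  ∃ t₀, l t₀ ∧ ∀ t, l t → ∀ t', l t' → g t = g t' → t = t₀ ∨ t' = t₀ ∨ t = t'

/-- If `g` identifies two elements, deleting one keeps the image, so the cardinality bound forces
injectivity on the rest. The resulting condition serves the combinatorics and, being a bounded
quantification over tiles, also the algorithm. -/
theorem card_le_card_image_add_one_iff {T C : Type*} [DecidableEq C] (τ : Finset T) (g : T → C) :
    τ.card ≤ (τ.image g).card + 1 ↔ τ = ∅ ∨ InjOffPoint g (· ∈ τ) := by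
  classical
  constructor
  · intro h
    rcases τ.eq_empty_or_nonempty with h0 | ⟨t₁, ht₁⟩
    · exact Or.inl h0
    right
    by_cases hinj : Set.InjOn g τ
    · exact ⟨t₁, ht₁, fun t ht t' ht' e => Or.inr (Or.inr (hinj ht ht' e))⟩
    simp only [Set.InjOn, Finset.mem_coe] at hinj
    push Not at hinj
    obtain ⟨a, ha, b, hb, hab, hne⟩ := hinj
    have himg : (τ.erase a).image g = τ.image g := by
      refine Finset.Subset.antisymm (Finset.image_subset_image (Finset.erase_subset _ _)) ?_
      intro c hc
      obtain ⟨t, ht, rfl⟩ := Finset.mem_image.1 hc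
      by_cases hta : t = a
      · subst hta
        exact Finset.mem_image.2 ⟨b, Finset.mem_erase.2 ⟨hne.symm, hb⟩, hab.symm⟩
      · exact Finset.mem_image_of_mem _ (Finset.mem_erase.2 ⟨hta, ht⟩)
    have hinj' : Set.InjOn g (τ.erase a) := by
      refine Finset.card_image_iff.1 (le_antisymm Finset.card_image_le ?_)
      rw [himg, Finset.card_erase_of_mem ha]
      omega
    refine ⟨a, ha, fun t ht t' ht' e => ?_⟩
    by_cases h1 : t = a
    · exact Or.inl h1
    by_cases h2 : t' = a
    · exact Or.inr (Or.inl h2)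
    exact Or.inr (Or.inr (hinj' (by simp [h1, ht]) (by simp [h2, ht']) e))
  · rintro (rfl | ⟨t₀, h₀, h⟩)
    · simp
    have hinj : Set.InjOn g (τ.erase t₀) := by
      intro t ht t' ht' e
      simp only [Finset.coe_erase, Set.mem_sdiff, Finset.mem_coe, Set.mem_singleton_iff] at ht ht'
      rcases h t ht.1 t' ht'.1 e with h | h | h
      · exact absurd h ht.2
      · exact absurd h ht'.2
      · exact h
    have h1 := Finset.card_image_iff.2 hinj
    have h2 := Finset.card_le_card (Finset.image_subset_image (f := g) (Finset.erase_subset t₀ τ))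
    rw [Finset.card_erase_of_mem h₀] at h1
    omega

theorem parameter_le_one_iff {C : Type*} [DecidableEq C] (τ : Tileset C) :
    Tileset.parameter τ ≤ 1 ↔ τ = ∅ ∨ InjOffPoint WangTile.e (· ∈ τ) ∨
      InjOffPoint WangTile.w (· ∈ τ) ∨ InjOffPoint WangTile.n (· ∈ τ) ∨
      InjOffPoint WangTile.s (· ∈ τ) := by
  have h1 := card_le_card_image_add_one_iff τ WangTile.e
  have h2 := card_le_card_image_add_one_iff τ WangTile.w
  have h3 := card_le_card_image_add_one_iff τ WangTile.n
  have h4 := card_le_card_image_add_one_iff τ WangTile.s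
  have key : ∀ N a b c d : ℕ, N - max (max a b) (max c d) ≤ 1 ↔
      N ≤ a + 1 ∨ N ≤ b + 1 ∨ N ≤ c + 1 ∨ N ≤ d + 1 := by
    intros; omega
  rw [Tileset.parameter, Tileset.numTiles, Tileset.numColors, key, h1, h2, h3, h4]
  by_cases h0 : τ = ∅ <;> simp only [h0, true_or, false_or]

/-- At most one other element shares the label of `t₀`, since two such would coincide. If there is
none, the degenerate choice `x = y = t₀` works. -/
theorem InjOffPoint.oneCollision {T C : Type*} {g : T → C} {l : T → Prop} (h : InjOffPoint g l) :
    ∃ x y : {t // l t}, OneCollision (fun t => g t.1) x y := by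
  obtain ⟨t₀, h₀, h⟩ := h
  by_cases hex : ∃ t, l t ∧ t ≠ t₀ ∧ g t = g t₀
  · obtain ⟨t₁, h₁, hne, heq⟩ := hex
    refine ⟨⟨t₀, h₀⟩, ⟨t₁, h₁⟩, heq.symm, ?_⟩
    rintro ⟨t, ht⟩ ⟨t', ht'⟩ e
    simp only [Subtype.mk.injEq] at e ⊢
    have a := h t ht t' ht' e
    have b := h t ht t₁ h₁
    have c := h t' ht' t₁ h₁
    grind
  · push Not at hex
    refine ⟨⟨t₀, h₀⟩, ⟨t₀, h₀⟩, rfl, ?_⟩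
    rintro ⟨t, ht⟩ ⟨t', ht'⟩ e
    simp only [Subtype.mk.injEq] at e ⊢
    have a := h t ht t' ht' e
    have b := hex t ht
    have c := hex t' ht'
    grind

open Tileset in
-- The core result follows a row towards increasing `i` with the nearly injective label on the
-- entering side, here `w`. The other three sides reduce to it by reflecting or exchanging the
-- coordinates.
theorem tilesPeriodically_of_injOffPoint {C : Type*} {τ : Tileset C}
    (h : InjOffPoint WangTile.e (· ∈ τ) ∨
      InjOffPoint WangTile.w (· ∈ τ) ∨ InjOffPoint WangTile.n (· ∈ τ) ∨
      InjOffPoint WangTile.s (· ∈ τ)) (ht : Tiles τ) : TilesPeriodically τ := by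
  obtain ⟨f, hmem, hh, hv⟩ := ht
  let F : ℤ → ℤ → {t // t ∈ τ} := fun i j => ⟨f i j, hmem i j⟩
  rcases h with h | h | h | h
  all_goals obtain ⟨x, y, hE⟩ := h.oneCollision
  · obtain ⟨g, ⟨h1, h2⟩, p, hp, hper⟩ := hE.hasPeriodic (W := fun t => t.1.w) (N := fun t => t.1.n)
      (S := fun t => t.1.s) (f := fun i j => F (-i) j)
      ⟨fun i j => by simp [F, hh], fun i j => by simp [F, hv]⟩
    refine ⟨fun i j => (g (-i) j).1, ⟨fun i j => (g (-i) j).2, fun i j => ?_, fun i j => h2 _ _⟩,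
      p, hp, fun i j => ⟨?_, ?_⟩⟩
    · have := h1 (-(i + 1)) j
      rw [show -(i + 1) + 1 = -i by ring] at this
      exact this.symm
    · simp only
      rw [← (hper (-(i + p)) j).1]; congr 2; ring
    · simp only [(hper _ _).2]
  · obtain ⟨g, ⟨h1, h2⟩, p, hp, hper⟩ := hE.hasPeriodic (W := fun t => t.1.e) (N := fun t => t.1.n)
      (S := fun t => t.1.s) (f := F) ⟨fun i j => hh i j, fun i j => hv i j⟩
    exact ⟨fun i j => (g i j).1, ⟨fun i j => (g i j).2, h1, h2⟩, p, hp, fun i j =>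
      ⟨congrArg Subtype.val (hper i j).1, congrArg Subtype.val (hper i j).2⟩⟩
  · obtain ⟨g, ⟨h1, h2⟩, p, hp, hper⟩ := hE.hasPeriodic (W := fun t => t.1.s) (N := fun t => t.1.e)
      (S := fun t => t.1.w) (f := fun i j => F j (-i))
      ⟨fun i j => by simp [F, hv], fun i j => by simp [F, hh]⟩
    refine ⟨fun i j => (g (-j) i).1, ⟨fun i j => (g (-j) i).2, fun i j => h2 _ _, fun i j => ?_⟩,
      p, hp, fun i j => ⟨?_, ?_⟩⟩
    · have := h1 (-(j + 1)) i
      rw [show -(j + 1) + 1 = -j by ring] at this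
      exact this.symm
    · simp only [(hper _ _).2]
    · simp only
      rw [← (hper (-(j + p)) i).1]; congr 2; ring
  · obtain ⟨g, ⟨h1, h2⟩, p, hp, hper⟩ := hE.hasPeriodic (W := fun t => t.1.n) (N := fun t => t.1.e)
      (S := fun t => t.1.w) (f := fun i j => F j i) ⟨fun i j => hv j i, fun i j => hh j i⟩
    exact ⟨fun i j => (g j i).1, ⟨fun i j => (g j i).2, fun i j => h2 j i, fun i j => h1 j i⟩, p, hp,
      fun i j => ⟨congrArg Subtype.val (hper j i).2, congrArg Subtype.val (hper j i).1⟩⟩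

theorem tiles_iff_tilesPeriodically {C : Type*} [DecidableEq C] {τ : Tileset C}
    (h : Tileset.parameter τ ≤ 1) : Tileset.Tiles τ ↔ Tileset.TilesPeriodically τ := by
  refine ⟨fun ht => ?_, fun ⟨f, hf, _⟩ => ⟨f, hf⟩⟩
  rcases (parameter_le_one_iff τ).1 h with rfl | h
  · obtain ⟨f, hf, -⟩ := ht
    exact absurd (hf 0 0) (Finset.notMem_empty _)
  · exact tilesPeriodically_of_injOffPoint h ht
open Tileset

/-! ### Compactness -/

/-- `τ` tiles the square of side `n + 1`. -/
def TilesSquare {C : Type*} (τ : Tileset C) (n : ℕ) : Prop :=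
  ∃ g : ℕ → ℕ → WangTile C, (∀ i ≤ n, ∀ j ≤ n, g i j ∈ τ) ∧
    ∀ i < n, ∀ j < n, (g i j).e = (g (i + 1) j).w ∧ (g i j).n = (g i (j + 1)).s

theorem Tiles.tilesSquare {C : Type*} {τ : Tileset C} (h : Tiles τ) (n : ℕ) : TilesSquare τ n := by
  obtain ⟨f, h1, h2, h3⟩ := h
  exact ⟨fun i j => f i j, fun i _ j _ => h1 _ _, fun i _ j _ => ⟨h2 _ _, h3 _ _⟩⟩

/-- Centre ever larger squares at the origin and take an ultrafilter limit: at each cell one of the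
finitely many tiles occurs almost always. The clamped positions and the edges left unchecked at the
border leave every bounded window. -/
theorem tiles_of_tilesSquare {C : Type*} {τ : Tileset C} (h : ∀ n, TilesSquare τ n) : Tiles τ := by
  choose g hg hm using h
  let φ : Ultrafilter ℕ := Filter.hyperfilter ℕ
  have hcof : ∀ N : ℕ, ∀ᶠ n in (φ : Filter ℕ), N ≤ n := fun N =>
    Nat.hyperfilter_le_atTop (Filter.eventually_ge_atTop N)
  let G : ℕ → ℤ → ℤ → WangTile C := fun n i j => g (2 * n) (i + n).toNat (j + n).toNat
  have hGmem : ∀ i j, ∀ᶠ n in (φ : Filter ℕ), G n i j ∈ τ := by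
    intro i j
    filter_upwards [hcof (i.natAbs + j.natAbs)] with n hn
    exact hg _ _ (by omega) _ (by omega)
  have hlim : ∀ i j, ∃ t ∈ τ, ∀ᶠ n in (φ : Filter ℕ), G n i j = t := by
    intro i j
    have := (Ultrafilter.eventually_exists_mem_iff (f := φ) (is := (τ : Set (WangTile C)))
      (P := fun t n => G n i j = t) τ.finite_toSet).1
      ((hGmem i j).mono fun n hn => ⟨_, hn, rfl⟩)
    simpa using this
  choose f hf hlim using hlim
  refine ⟨f, hf, fun i j => ?_, fun i j => ?_⟩
  · obtain ⟨n, h1, h2, hn⟩ := ((hlim i j).and ((hlim (i + 1) j).and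
      (hcof (i.natAbs + j.natAbs + 1)))).exists
    have e : (i + 1 + n).toNat = (i + n).toNat + 1 := by omega
    have := (hm (2 * n) (i + n).toNat (by omega) (j + n).toNat (by omega)).1
    rw [← h1, ← h2]
    simp only [G, e, this]
  · obtain ⟨n, h1, h2, hn⟩ := ((hlim i j).and ((hlim i (j + 1)).and
      (hcof (i.natAbs + j.natAbs + 1)))).exists
    have e : (j + 1 + n).toNat = (j + n).toNat + 1 := by omega
    have := (hm (2 * n) (i + n).toNat (by omega) (j + n).toNat (by omega)).2
    rw [← h1, ← h2]
    simp only [G, e, this]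

/-! ### Patterns coded by natural numbers -/

/-- The tile at position `(i, j)` of the pattern of width `w` over the list `l` coded by `k`:
the digits of `k` in base `l.length` are indices in `l`. -/
def cell (l : List (WangTile ℕ)) (w k i j : ℕ) : WangTile ℕ :=
  l.getD (k / l.length ^ (i * w + j) % l.length) ⟨0, 0, 0, 0⟩

/-- Reduction mod the length keeps the index in range, so the default tile arises only for the empty
list and every number codes a pattern of tiles of `l`. -/
theorem cell_mem {l : List (WangTile ℕ)} (hl : l ≠ []) (w k i j : ℕ) : cell l w k i j ∈ l := by
  have := List.length_pos_iff.2 hl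
  have h := Nat.mod_lt (k / l.length ^ (i * w + j)) this
  rw [cell, List.getD_eq_getElem _ _ h]
  exact List.getElem_mem h

theorem exists_cell_eq {l : List (WangTile ℕ)} (w : ℕ) (g : ℕ → ℕ → WangTile ℕ)
    (hg : ∀ i < w, ∀ j < w, g i j ∈ l) :
    ∃ k < l.length ^ (w * w), ∀ i < w, ∀ j < w, cell l w k i j = g i j := by
  have hdm : ∀ m : Fin (w * w), (m : ℕ) / w < w ∧ (m : ℕ) % w < w := by
    intro m
    have hw : 0 < w := by
      rcases Nat.eq_zero_or_pos w with rfl | h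
      · exact absurd m.2 (by simp)
      · exact h
    exact ⟨Nat.div_lt_of_lt_mul m.2, Nat.mod_lt _ hw⟩
  have : ∀ m : Fin (w * w), ∃ d : Fin l.length, l[d] = g (m / w) (m % w) := by
    intro m
    obtain ⟨d, hd, h⟩ := List.getElem_of_mem (hg _ (hdm m).1 _ (hdm m).2)
    exact ⟨⟨d, hd⟩, h⟩
  choose d hd using this
  -- The chosen indices become base `l.length` digits. The bound on `k` is what makes the search
  -- over square patterns finite.
  refine ⟨finFunctionFinEquiv d, (finFunctionFinEquiv d).2, fun i hi j hj => ?_⟩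
  have hlt : i * w + j < w * w := by nlinarith
  have h1 : (finFunctionFinEquiv d : ℕ) / l.length ^ (i * w + j) % l.length =
      d ⟨i * w + j, hlt⟩ := by
    conv_rhs => rw [← finFunctionFinEquiv.symm_apply_apply d]
    rfl
  have h2 := hd ⟨i * w + j, hlt⟩
  have e1 : (i * w + j) / w = i := by
    rw [mul_comm, Nat.mul_add_div (by omega), Nat.div_eq_of_lt hj, add_zero]
  have e2 : (i * w + j) % w = j := by
    rw [mul_comm, Nat.mul_add_mod, Nat.mod_eq_of_lt hj]
  simp only [e1, e2] at h2
  rw [cell, h1, ← h2, List.getD_eq_getElem _ _ (d _).2]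
  rfl

/-- The pattern coded by `k` is a valid pattern on the torus of side `p`. -/
def TorusCode (l : List (WangTile ℕ)) (p k : ℕ) : Prop :=
  ∀ i < p, ∀ j < p, (cell l p k i j).e = (cell l p k ((i + 1) % p) j).w ∧
    (cell l p k i j).n = (cell l p k i ((j + 1) % p)).s

/-- The pattern coded by `k` is a valid pattern on the square of side `p + 1`. -/
def SquareCode (l : List (WangTile ℕ)) (p k : ℕ) : Prop :=
  ∀ i < p, ∀ j < p, (cell l (p + 1) k i j).e = (cell l (p + 1) k (i + 1) j).w ∧
    (cell l (p + 1) k i j).n = (cell l (p + 1) k i (j + 1)).s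

theorem tilesPeriodically_ofList_iff (l : List (WangTile ℕ)) :
    TilesPeriodically (ofList l) ↔ l ≠ [] ∧ ∃ p k, 0 < p ∧ TorusCode l p k := by
  constructor
  · rintro ⟨f, ⟨h1, h2, h3⟩, p, hp, hper⟩
    have hmem : ∀ i j, f i j ∈ l := fun i j => List.mem_toFinset.1 (h1 i j)
    obtain ⟨p, rfl⟩ := Int.eq_ofNat_of_zero_le hp.le
    have hp' : 0 < p := by exact_mod_cast hp
    refine ⟨fun h => by simpa [h] using hmem 0 0, p, ?_⟩
    obtain ⟨k, -, hk⟩ := exists_cell_eq (l := l) p (fun i j => f i j) (fun i _ j _ => hmem _ _)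
    have hmod : ∀ i < p, ∀ x : ℤ, f ((i + 1) % p : ℕ) x = f (i + 1) x ∧
        f x ((i + 1) % p : ℕ) = f x (i + 1) := by
      intro i hi x
      rcases Nat.lt_or_ge (i + 1) p with h | h
      · rw [Nat.mod_eq_of_lt h]; simp
      · have : i + 1 = p := by omega
        have e : (i : ℤ) + 1 = 0 + p := by rw [← this]; push_cast; ring
        rw [e, (hper _ _).1, (hper _ _).2, this]
        simp
    refine ⟨k, hp', fun i hi j hj => ?_⟩
    rw [hk i hi j hj, hk _ (Nat.mod_lt _ hp') j hj, hk i hi _ (Nat.mod_lt _ hp'),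
      (hmod i hi _).1, (hmod j hj _).2]
    exact ⟨h2 _ _, h3 _ _⟩
  · rintro ⟨hl, p, k, hp, h⟩
    have hp' : (0 : ℤ) < p := by exact_mod_cast hp
    have hlt : ∀ i : ℤ, (i % p).toNat < p := fun i => by
      have := Int.emod_lt_of_pos i hp'
      have := Int.emod_nonneg i hp'.ne'
      omega
    have hsucc : ∀ i : ℤ, ((i + 1) % p).toNat = ((i % p).toNat + 1) % p := by
      intro i
      have h0 := Int.emod_nonneg i hp'.ne'
      zify
      rw [Int.toNat_of_nonneg h0, Int.toNat_of_nonneg (Int.emod_nonneg _ hp'.ne')]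
      simp
    refine ⟨fun i j => cell l p k (i % p).toNat (j % p).toNat, ⟨fun i j => ?_, fun i j => ?_,
      fun i j => ?_⟩, p, hp', fun i j => by simp⟩
    · exact List.mem_toFinset.2 (cell_mem hl _ _ _ _)
    · simp only [hsucc]; exact (h _ (hlt i) _ (hlt j)).1
    · simp only [hsucc]; exact (h _ (hlt i) _ (hlt j)).2

theorem tilesSquare_ofList_iff {l : List (WangTile ℕ)} (hl : l ≠ []) (n : ℕ) :
    TilesSquare (ofList l) n ↔ ∃ k < l.length ^ ((n + 1) * (n + 1)), SquareCode l n k := by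
  constructor
  · rintro ⟨g, h1, h2⟩
    obtain ⟨k, hk, hc⟩ := exists_cell_eq (l := l) (n + 1) g
      (fun i hi j hj => List.mem_toFinset.1 (h1 i (by omega) j (by omega)))
    refine ⟨k, hk, fun i hi j hj => ?_⟩
    rw [hc i (by omega) j (by omega), hc (i + 1) (by omega) j (by omega),
      hc i (by omega) (j + 1) (by omega)]
    exact h2 i hi j hj
  · rintro ⟨k, -, h⟩
    exact ⟨cell l (n + 1) k, fun i _ j _ => List.mem_toFinset.2 (cell_mem hl _ _ _ _), h⟩

/-! ### Computability -/

theorem rePred_exists {α : Type*} [Primcodable α] {P : α → ℕ → Prop} (hP : PrimrecRel P) :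
    REPred fun a => ∃ n, P a n := by
  classical
  have h : Partrec fun a => Nat.rfind fun n => (Part.some (decide (P a n)) : Part Bool) :=
    Partrec.rfind (Computable.partrec (Primrec.to_comp hP.decide))
  refine h.dom_re.of_eq fun a => ?_
  refine Nat.rfind_dom'.trans ?_
  simp

theorem primrec_tile_proj : Primrec (WangTile.e (C := ℕ)) ∧ Primrec (WangTile.w (C := ℕ)) ∧
    Primrec (WangTile.n (C := ℕ)) ∧ Primrec (WangTile.s (C := ℕ)) := by
  have h : Primrec (WangTile.equivProd ℕ) := Primrec.of_equiv
  exact ⟨Primrec.fst.comp h, Primrec.fst.comp (Primrec.snd.comp h),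
    Primrec.fst.comp (Primrec.snd.comp (Primrec.snd.comp h)),
    Primrec.snd.comp (Primrec.snd.comp (Primrec.snd.comp h))⟩

theorem primrec_cell {α : Type*} [Primcodable α] {l : α → List (WangTile ℕ)} {w k i j : α → ℕ}
    (hl : Primrec l) (hw : Primrec w) (hk : Primrec k) (hi : Primrec i) (hj : Primrec j) :
    Primrec fun a => cell (l a) (w a) (k a) (i a) (j a) := by
  have hpow : Primrec₂ ((· ^ ·) : ℕ → ℕ → ℕ) := Primrec₂.unpaired'.1 Nat.Primrec.pow
  have hlen := Primrec.list_length.comp hl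
  exact (Primrec.list_getD _).comp hl (Primrec.nat_mod.comp (Primrec.nat_div.comp hk
    (hpow.comp hlen (Primrec.nat_add.comp (Primrec.nat_mul.comp hi hw) hj))) hlen)

theorem primrecPred_forall_lt {α : Type*} [Primcodable α] {R : α → ℕ → Prop} {b : α → ℕ}
    (hb : Primrec b) (hR : PrimrecRel R) : PrimrecPred fun a => ∀ i < b a, R a i := by
  have h : PrimrecRel fun (i : ℕ) (a : α) => R a i := hR.comp Primrec.snd Primrec.fst
  exact (h.forall_mem_list.comp (Primrec.list_range.comp hb) Primrec.id).of_eq (by simp)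

theorem primrecPred_exists_lt {α : Type*} [Primcodable α] {R : α → ℕ → Prop} {b : α → ℕ}
    (hb : Primrec b) (hR : PrimrecRel R) : PrimrecPred fun a => ∃ i < b a, R a i := by
  have h : PrimrecRel fun (i : ℕ) (a : α) => R a i := hR.comp Primrec.snd Primrec.fst
  exact (h.exists_mem_list.comp (Primrec.list_range.comp hb) Primrec.id).of_eq (by simp)

open Primrec in
theorem primrecPred_torusCode :
    PrimrecPred fun a : List (WangTile ℕ) × ℕ × ℕ => TorusCode a.1 a.2.1 a.2.2 := by
  obtain ⟨he, hw, hn, hs⟩ := primrec_tile_proj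
  have hp : Primrec fun a : List (WangTile ℕ) × ℕ × ℕ => a.2.1 := fst.comp snd
  refine primrecPred_forall_lt hp (primrecPred_forall_lt (hp.comp fst) ?_)
  have hl : Primrec fun a : ((List (WangTile ℕ) × ℕ × ℕ) × ℕ) × ℕ => a.1.1.1 :=
    fst.comp (fst.comp fst)
  have hp : Primrec fun a : ((List (WangTile ℕ) × ℕ × ℕ) × ℕ) × ℕ => a.1.1.2.1 :=
    fst.comp (snd.comp (fst.comp fst))
  have hk : Primrec fun a : ((List (WangTile ℕ) × ℕ × ℕ) × ℕ) × ℕ => a.1.1.2.2 :=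
    snd.comp (snd.comp (fst.comp fst))
  have hi : Primrec fun a : ((List (WangTile ℕ) × ℕ × ℕ) × ℕ) × ℕ => a.1.2 := snd.comp fst
  have hj : Primrec fun a : ((List (WangTile ℕ) × ℕ × ℕ) × ℕ) × ℕ => a.2 := snd
  have hc := primrec_cell hl hp hk hi hj
  exact (Primrec.eq.comp (he.comp hc)
      (hw.comp (primrec_cell hl hp hk (nat_mod.comp (succ.comp hi) hp) hj))).and
    (Primrec.eq.comp (hn.comp hc)
      (hs.comp (primrec_cell hl hp hk hi (nat_mod.comp (succ.comp hj) hp))))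

open Primrec in
theorem primrecPred_squareCode :
    PrimrecPred fun a : List (WangTile ℕ) × ℕ × ℕ => SquareCode a.1 a.2.1 a.2.2 := by
  obtain ⟨he, hw, hn, hs⟩ := primrec_tile_proj
  have hp : Primrec fun a : List (WangTile ℕ) × ℕ × ℕ => a.2.1 := fst.comp snd
  refine primrecPred_forall_lt hp (primrecPred_forall_lt (hp.comp fst) ?_)
  have hl : Primrec fun a : ((List (WangTile ℕ) × ℕ × ℕ) × ℕ) × ℕ => a.1.1.1 :=
    fst.comp (fst.comp fst)
  have hp : Primrec fun a : ((List (WangTile ℕ) × ℕ × ℕ) × ℕ) × ℕ => a.1.1.2.1 + 1 :=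
    succ.comp (fst.comp (snd.comp (fst.comp fst)))
  have hk : Primrec fun a : ((List (WangTile ℕ) × ℕ × ℕ) × ℕ) × ℕ => a.1.1.2.2 :=
    snd.comp (snd.comp (fst.comp fst))
  have hi : Primrec fun a : ((List (WangTile ℕ) × ℕ × ℕ) × ℕ) × ℕ => a.1.2 := snd.comp fst
  have hj : Primrec fun a : ((List (WangTile ℕ) × ℕ × ℕ) × ℕ) × ℕ => a.2 := snd
  have hc := primrec_cell hl hp hk hi hj
  exact (Primrec.eq.comp (he.comp hc)
      (hw.comp (primrec_cell hl hp hk (succ.comp hi) hj))).and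
    (Primrec.eq.comp (hn.comp hc) (hs.comp (primrec_cell hl hp hk hi (succ.comp hj))))

open Primrec in
theorem primrecPred_injOffPoint {g : WangTile ℕ → ℕ} (hg : Primrec g) :
    PrimrecPred fun l : List (WangTile ℕ) => InjOffPoint g (· ∈ ofList l) := by
  let R : WangTile ℕ → WangTile ℕ → WangTile ℕ → Prop := fun t₀ t t' =>
    ¬ g t = g t' ∨ t = t₀ ∨ t' = t₀ ∨ t = t'
  have h1 : PrimrecRel fun (t' : WangTile ℕ) (a : WangTile ℕ × WangTile ℕ) => R a.2 a.1 t' := by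
    have e0 : Primrec fun b : WangTile ℕ × WangTile ℕ × WangTile ℕ => b.2.2 := snd.comp snd
    have e1 : Primrec fun b : WangTile ℕ × WangTile ℕ × WangTile ℕ => b.2.1 := fst.comp snd
    exact (Primrec.eq.comp (hg.comp e1) (hg.comp fst)).not.or ((Primrec.eq.comp e1 e0).or
      ((Primrec.eq.comp fst e0).or (Primrec.eq.comp e1 fst)))
  have h2 : PrimrecRel fun (t : WangTile ℕ) (a : WangTile ℕ × List (WangTile ℕ)) =>
      ∀ t' ∈ a.2, R a.1 t t' :=
    h1.forall_mem_list.comp (snd.comp snd) (fst.pair (fst.comp snd))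
  have h3 : PrimrecRel fun (t₀ : WangTile ℕ) (l : List (WangTile ℕ)) =>
      ∀ t ∈ l, ∀ t' ∈ l, R t₀ t t' :=
    h2.forall_mem_list.comp snd Primrec.id
  refine (h3.exists_mem_list.comp Primrec.id Primrec.id).of_eq fun l => ?_
  simp only [InjOffPoint, ofList, List.mem_toFinset, R, id, ← imp_iff_not_or]

theorem primrecPred_parameter_le_one :
    PrimrecPred fun l : List (WangTile ℕ) => parameter (ofList l) ≤ 1 := by
  obtain ⟨he, hw, hn, hs⟩ := primrec_tile_proj
  refine ((Primrec.eq.comp Primrec.id (Primrec.const [])).or ((primrecPred_injOffPoint he).or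
    ((primrecPred_injOffPoint hw).or ((primrecPred_injOffPoint hn).or
    (primrecPred_injOffPoint hs))))).of_eq fun l => ?_
  rw [parameter_le_one_iff]
  simp [ofList]

open Primrec in
-- Post's theorem: the set is recursively enumerable through torus codes, its complement through
-- untileable squares, where the finitely many codes can all be tested.
theorem computablePred_tiles :
    ComputablePred fun l : List (WangTile ℕ) => parameter (ofList l) ≤ 1 ∧ Tiles (ofList l) := by
  have hne : PrimrecPred fun l : List (WangTile ℕ) => l = [] := Primrec.eq.comp Primrec.id (const [])
  have hpar := primrecPred_parameter_le_one
  refine ComputablePred.computable_iff_re_compl_re'.2 ⟨?_, ?_⟩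
  · have h : PrimrecRel fun (l : List (WangTile ℕ)) (m : ℕ) => parameter (ofList l) ≤ 1 ∧ ¬ l = [] ∧
        0 < m.unpair.1 ∧ TorusCode l m.unpair.1 m.unpair.2 := by
      have hu : Primrec fun a : List (WangTile ℕ) × ℕ => a.2.unpair := unpair.comp snd
      exact (hpar.comp fst).and ((hne.comp fst).not.and
        ((nat_lt.comp (const 0) (fst.comp hu)).and (primrecPred_torusCode.comp (fst.pair hu))))
    refine (rePred_exists h).of_eq fun l => ?_
    constructor
    · rintro ⟨m, h1, h2, h3, h4⟩
      exact ⟨h1, (tiles_iff_tilesPeriodically h1).2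
        ((tilesPeriodically_ofList_iff l).2 ⟨h2, _, _, h3, h4⟩)⟩
    · rintro ⟨h1, h2⟩
      obtain ⟨h2, p, k, h3, h4⟩ :=
        (tilesPeriodically_ofList_iff l).1 ((tiles_iff_tilesPeriodically h1).1 h2)
      exact ⟨Nat.pair p k, h1, h2, by simpa using h3, by simpa using h4⟩
  · have h : PrimrecRel fun (l : List (WangTile ℕ)) (m : ℕ) => ¬ parameter (ofList l) ≤ 1 ∨ l = [] ∨
        ¬ ∃ k < l.length ^ ((m + 1) * (m + 1)), SquareCode l m k := by
      refine (hpar.comp fst).not.or ((hne.comp fst).or (primrecPred_exists_lt ?_ ?_).not)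
      · have hpow : Primrec₂ ((· ^ ·) : ℕ → ℕ → ℕ) := Primrec₂.unpaired'.1 Nat.Primrec.pow
        exact hpow.comp (list_length.comp fst) (nat_mul.comp (succ.comp snd) (succ.comp snd))
      · exact primrecPred_squareCode.comp ((fst.comp fst).pair ((snd.comp fst).pair snd))
    refine (rePred_exists h).of_eq fun l => ?_
    constructor
    · rintro ⟨m, h1 | rfl | h1⟩ ⟨h2, h3⟩
      · exact h1 h2
      · obtain ⟨f, hf, -⟩ := h3
        simpa [ofList] using hf 0 0
      · have hl : l ≠ [] := by
          rintro rfl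
          obtain ⟨f, hf, -⟩ := h3
          simpa [ofList] using hf 0 0
        exact h1 ((tilesSquare_ofList_iff hl m).1 (Tiles.tilesSquare h3 m))
    · intro hnot
      by_cases h1 : parameter (ofList l) ≤ 1
      · by_cases hl : l = []
        · exact ⟨0, Or.inr (Or.inl hl)⟩
        by_contra hall
        push Not at hall
        exact hnot ⟨h1, tiles_of_tilesSquare fun n =>
          (tilesSquare_ofList_iff hl n).2 (hall n).2.2⟩
      · exact ⟨0, Or.inl h1⟩

end WangDet

theorem mainTheorem3 :
    -- the domino problem restricted to tilesets of parameter at most one is decidable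
    ComputablePred (fun l : List (WangTile ℕ) =>
      Tileset.parameter (Tileset.ofList l) ≤ 1 ∧ Tileset.Tiles (Tileset.ofList l)) ∧
    -- such a tileset tiles the plane if and only if it admits a periodic tiling
    (∀ (C : Type*) [DecidableEq C] (τ : Tileset C), Tileset.parameter τ ≤ 1 →
      (Tileset.Tiles τ ↔ Tileset.TilesPeriodically τ)) :=
  ⟨WangDet.computablePred_tiles, fun _ _ _ h => WangDet.tiles_iff_tilesPeriodically h⟩
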